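/- A minimal open projection in a $C^*$-algebra $A$ is a nonzero projection $p\in A$ with $pAp=\mathbb{C}p$. By an ideal in a $C^*$-algebra we mean a closed, two-sided ideal. A $C^*$-algebra $A$ is called nowhere scattered if for no ideal $I\subseteq A$ does the quotient $A/I$ contain a minimal open projection. A sub-$C^*$-algebra $B\subseteq A$ is hereditary if $0\le a\le b$ with $a\in A$ and $b\in B$ implies $a\in B$. A family $(A_\lambda)_{\lambda\in\Lambda}$ of sub-$C^*$-algebras of $A$ approximates $A$ if for all $a_1,\dots,a_n\in A$ and every $\varepsilon>0$ there are $\lambda\in\Lambda$ and $b_1,\dots,b_n\in A_\lambda$ with $\|a_k-b_k\|<\varepsilon$ for $k=1,\dots,n$. (1) Let $A$ be a nowhere scattered $C^*$-algebra. Then every quotient $A/I$ by an ideal $I\subseteq A$ and every hereditary sub-$C^*$-algebra of $A$ is nowhere scattered; in particular, every ideal of $A$ is nowhere scattered. (2) Let $A$ be a $C^*$-algebra, and let $(A_\lambda)_{\lambda\in\Lambda}$ be a family of nowhere scattered sub-$C^*$-algebras of $A$ that approximates $A$. Then $A$ is nowhere scattered. (3) Let $\Lambda$ be a nonempty directed set,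 let $(A_\lambda)_{\lambda\in\Lambda}$ be a family of nowhere scattered $C^*$-algebras with coherent connecting $*$-homomorphisms $\varphi_{\kappa,\lambda}\colon A_\lambda\to A_\kappa$ for $\lambda\le\kappa$. Then the inductive limit of this system (its colimit in the category of $C^*$-algebras and $*$-homomorphisms) is nowhere scattered. -/

import Mathlib

universe u v

noncomputable section

/-! ### Closed two-sided ideals of C⋆-algebras -/

/-- Local approximate units: for `c` there is a self-adjoint `u = c⋆ c w` that almost acts as a
right unit on `c`, and such that right multiplication by `1 - u` is contractive. -/
theorem exists_local_unit {A : Type*} [NonUnitalCStarAlgebra A] (c : A) {ε : ℝ} (hε : 0 < ε) :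
    ∃ u w : A, u = star c * c * w ∧ IsSelfAdjoint u ∧ ‖c - c * u‖ ≤ ε ∧
      ∀ x : A, ‖x - x * u‖ ≤ ‖x‖ := by
  set b : A := star c * c with hb
  have hbs : IsSelfAdjoint b := .star_mul_self c
  set n : ℝ := (ε ^ 4)⁻¹ with hn
  have hn0 : 0 < n := by positivity
  have hpos : ∀ x : ℝ, 0 < 1 + n * x ^ 2 := fun x => by positivity
  let f : ℝ → ℝ := fun x => n * x ^ 2 / (1 + n * x ^ 2)
  let g : ℝ → ℝ := fun x => n * x / (1 + n * x ^ 2)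
  have hf : Continuous f := by
    refine Continuous.div (by fun_prop) (by fun_prop) fun x => (hpos x).ne'
  have hg : Continuous g := by
    refine Continuous.div (by fun_prop) (by fun_prop) fun x => (hpos x).ne'
  have hf0 : f 0 = 0 := by simp [f]
  have hg0 : g 0 = 0 := by simp [g]
  have hub : cfcₙ f b = b * cfcₙ g b := by
    have h : cfcₙ (fun x : ℝ => x * g x) b = b * cfcₙ g b := by
      rw [cfcₙ_mul (fun x : ℝ => x) g b (by fun_prop) rfl hg.continuousOn hg0, cfcₙ_id' ℝ b]
    rw [← h]
    congr 1
    ext x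
    simp only [f, g]
    ring
  have hus : IsSelfAdjoint (cfcₙ f b) := cfcₙ_predicate f b
  refine ⟨cfcₙ f b, cfcₙ g b, hub, hus, ?_, ?_⟩
  · have key : star (c - c * cfcₙ f b) * (c - c * cfcₙ f b)
        = cfcₙ (fun x => (x - x * f x) - f x * (x - x * f x)) b := by
      have h1 : cfcₙ (fun x : ℝ => x - x * f x) b = b - b * cfcₙ f b := by
        rw [cfcₙ_sub (fun x : ℝ => x) (fun x => x * f x) b (by fun_prop) rfl
          (by fun_prop) (by simp), cfcₙ_mul (fun x : ℝ => x) f b (by fun_prop) rfl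
          (by fun_prop) hf0, cfcₙ_id' ℝ b]
      rw [cfcₙ_sub (fun x : ℝ => x - x * f x) (fun x => f x * (x - x * f x)) b (by fun_prop)
        (by simp) (by fun_prop) (by simp), cfcₙ_mul f (fun x : ℝ => x - x * f x) b (by fun_prop)
        hf0 (by fun_prop) (by simp), h1, star_sub, star_mul, hus.star_eq, hb]
      noncomm_ring
    have hle : ‖star (c - c * cfcₙ f b) * (c - c * cfcₙ f b)‖ ≤ ε ^ 2 := by
      rw [key]
      refine norm_cfcₙ_le fun x _ => ?_
      have hx : (x - x * f x) - f x * (x - x * f x) = x / (1 + n * x ^ 2) ^ 2 := by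
        have := (hpos x).ne'
        simp only [f]
        field_simp
        ring
      rw [hx, Real.norm_eq_abs, abs_div, abs_of_pos (pow_pos (hpos x) 2),
        div_le_iff₀ (pow_pos (hpos x) 2)]
      have e4 : n * ε ^ 4 = 1 := by rw [hn]; field_simp
      have h2 : |x| ≤ ε ^ 2 * (1 + n * x ^ 2) := by
        have h3 : |x| ^ 2 = x ^ 2 := sq_abs x
        have h4 : ε ^ 2 * (ε ^ 2 * (1 + n * x ^ 2)) = ε ^ 4 + x ^ 2 := by
          linear_combination x ^ 2 * e4
        have h5 : ε ^ 2 * |x| ≤ ε ^ 2 * (ε ^ 2 * (1 + n * x ^ 2)) := by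
          rw [h4]
          nlinarith [sq_nonneg (ε ^ 2 - |x|), sq_nonneg (ε ^ 2 + |x|), abs_nonneg x]
        exact le_of_mul_le_mul_left h5 (by positivity)
      refine h2.trans ?_
      have h6 : 1 ≤ 1 + n * x ^ 2 := by nlinarith [mul_nonneg hn0.le (sq_nonneg x)]
      nlinarith [mul_nonneg (sq_nonneg ε) (mul_nonneg (hpos x).le (sub_nonneg.2 h6))]
    rw [CStarRing.norm_star_mul_self] at hle
    exact abs_le_of_sq_le_sq' (by nlinarith) hε.le |>.2
  · intro x
    have h1 : ‖(1 : Unitization ℂ A) - (cfcₙ f b : A)‖ ≤ 1 := by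
      have hbs' : IsSelfAdjoint (b : Unitization ℂ A) := hbs.inr ℂ
      rw [Unitization.real_cfcₙ_eq_cfc_inr b f hf0, ← cfc_const_one ℝ (b : Unitization ℂ A),
        ← cfc_sub (fun _ => (1 : ℝ)) f (b : Unitization ℂ A) (by fun_prop) (by fun_prop)]
      refine norm_cfc_le zero_le_one fun y _ => ?_
      have hy : 1 - f y = 1 / (1 + n * y ^ 2) := by
        have := (hpos y).ne'
        simp only [f]
        field_simp
        ring
      rw [hy, Real.norm_eq_abs, abs_of_pos (by have := hpos y; positivity),
        div_le_one (hpos y)]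
      nlinarith [mul_nonneg hn0.le (sq_nonneg y)]
    have h2 : ((x - x * cfcₙ f b : A) : Unitization ℂ A)
        = (x : Unitization ℂ A) * (1 - (cfcₙ f b : A)) := by
      rw [mul_sub, mul_one, ← Unitization.inr_mul, Unitization.inr_sub]
    rw [← Unitization.norm_inr (𝕜 := ℂ), h2, ← Unitization.norm_inr (𝕜 := ℂ) (a := x)]
    calc _ ≤ ‖(x : Unitization ℂ A)‖ * ‖(1 : Unitization ℂ A) - (cfcₙ f b : A)‖ := norm_mul_le _ _
      _ ≤ _ := mul_le_of_le_one_right (norm_nonneg _) h1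

section Ideal

variable {A : Type*} [NonUnitalCStarAlgebra A] (I : TwoSidedIdeal A)

/-- Closed two-sided ideals of C⋆-algebras are automatically self-adjoint. -/
theorem TwoSidedIdeal.star_mem_of_isClosed [hI : IsClosed (I : Set A)] {a : A} (ha : a ∈ I) :
    star a ∈ I := by
  have : star a ∈ closure (I : Set A) := by
    refine Metric.mem_closure_iff.2 fun ε hε => ?_
    obtain ⟨u, w, rfl, -, hu, -⟩ := exists_local_unit (star a) (half_pos hε)
    refine ⟨star a * (star (star a) * star a * w), ?_, ?_⟩
    · rw [star_star]
      exact I.mul_mem_left _ _ (I.mul_mem_right _ _ (I.mul_mem_right _ _ ha))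
    · rw [dist_eq_norm]
      linarith
  rwa [hI.closure_eq] at this

/-- Closed two-sided ideals of C⋆-algebras are automatically complex subspaces. -/
theorem TwoSidedIdeal.smul_mem_of_isClosed [hI : IsClosed (I : Set A)] (z : ℂ) {a : A}
    (ha : a ∈ I) : z • a ∈ I := by
  have : z • a ∈ closure (I : Set A) := by
    refine Metric.mem_closure_iff.2 fun ε hε => ?_
    obtain ⟨u, w, -, -, hu, -⟩ := exists_local_unit (z • a) (half_pos hε)
    refine ⟨z • a * u, ?_, ?_⟩
    · rw [smul_mul_assoc, ← mul_smul_comm]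
      exact I.mul_mem_right _ _ ha
    · rw [dist_eq_norm]
      linarith
  rwa [hI.closure_eq] at this

/-- A closed two-sided ideal of a C⋆-algebra, as a sub-C⋆-algebra. -/
def TwoSidedIdeal.toSubCStar [IsClosed (I : Set A)] : NonUnitalStarSubalgebra ℂ A where
  carrier := I
  add_mem' := I.add_mem
  zero_mem' := I.zero_mem
  mul_mem' := fun {a _} _ hb => I.mul_mem_left a _ hb
  smul_mem' := fun z _ ha => I.smul_mem_of_isClosed z ha
  star_mem' := fun ha => I.star_mem_of_isClosed ha

instance TwoSidedIdeal.isClosed_toSubCStar [hI : IsClosed (I : Set A)] :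
    IsClosed (I.toSubCStar : Set A) := hI

/-! ### The quotient C⋆-algebra -/

/-- The quotient `A / I` of a C⋆-algebra by a closed two-sided ideal. As a Banach space, it is the
quotient by the underlying closed subspace, with the quotient norm. -/
def CStarQuotient [IsClosed (I : Set A)] : Type _ :=
  A ⧸ I.toSubCStar.toNonUnitalSubalgebra.toSubmodule

namespace CStarQuotient

variable [hI : IsClosed (I : Set A)]

instance isClosed_toSubmodule :
    IsClosed (I.toSubCStar.toNonUnitalSubalgebra.toSubmodule : Set A) := hI

instance : NormedAddCommGroup (CStarQuotient I) :=
  inferInstanceAs (NormedAddCommGroup (A ⧸ I.toSubCStar.toNonUnitalSubalgebra.toSubmodule))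

instance : NormedSpace ℂ (CStarQuotient I) :=
  inferInstanceAs (NormedSpace ℂ (A ⧸ I.toSubCStar.toNonUnitalSubalgebra.toSubmodule))

instance : CompleteSpace (CStarQuotient I) :=
  inferInstanceAs (CompleteSpace (A ⧸ I.toSubCStar.toNonUnitalSubalgebra.toSubmodule))

/-- The quotient map `A → A / I`. -/
def mk : A →ₗ[ℂ] CStarQuotient I := I.toSubCStar.toNonUnitalSubalgebra.toSubmodule.mkQ

variable {I}

theorem mk_surjective : Function.Surjective (mk I) := Submodule.mkQ_surjective _

theorem mk_eq_mk {a b : A} : mk I a = mk I b ↔ a - b ∈ I := Submodule.Quotient.eq _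

theorem norm_mk_le (a : A) : ‖mk I a‖ ≤ ‖a‖ :=
  Submodule.Quotient.norm_mk_le I.toSubCStar.toNonUnitalSubalgebra.toSubmodule a

theorem exists_norm_lt (x : CStarQuotient I) {ε : ℝ} (hε : 0 < ε) :
    ∃ a : A, mk I a = x ∧ ‖a‖ < ‖x‖ + ε := Submodule.Quotient.norm_mk_lt x hε

instance : Mul (CStarQuotient I) where
  mul := Quotient.map₂ (· * ·) fun a a' h b b' h' => by
    replace h : a - a' ∈ I := (Submodule.quotientRel_def _).1 h
    replace h' : b - b' ∈ I := (Submodule.quotientRel_def _).1 h'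
    refine (Submodule.quotientRel_def _).2 ?_
    have : a * b - a' * b' = (a - a') * b + a' * (b - b') := by noncomm_ring
    change a * b - a' * b' ∈ I
    rw [this]
    exact I.add_mem (I.mul_mem_right _ _ h) (I.mul_mem_left _ _ h')

instance : Star (CStarQuotient I) where
  star := Quotient.map star fun a a' h => by
    replace h : a - a' ∈ I := (Submodule.quotientRel_def _).1 h
    refine (Submodule.quotientRel_def _).2 ?_
    change star a - star a' ∈ I
    rw [← star_sub]
    exact I.star_mem_of_isClosed h

theorem mk_mul (a b : A) : mk I (a * b) = mk I a * mk I b := rfl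

theorem mk_star (a : A) : mk I (star a) = star (mk I a) := rfl

instance : NonUnitalNormedRing (CStarQuotient I) where
  __ := (inferInstance : NormedAddCommGroup (CStarQuotient I))
  left_distrib x y z := by
    obtain ⟨a, rfl⟩ := mk_surjective x
    obtain ⟨b, rfl⟩ := mk_surjective y
    obtain ⟨c, rfl⟩ := mk_surjective z
    simp only [← map_add, ← mk_mul, mul_add]
  right_distrib x y z := by
    obtain ⟨a, rfl⟩ := mk_surjective x
    obtain ⟨b, rfl⟩ := mk_surjective y
    obtain ⟨c, rfl⟩ := mk_surjective z
    simp only [← map_add, ← mk_mul, add_mul]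
  zero_mul x := by
    obtain ⟨a, rfl⟩ := mk_surjective x
    rw [← map_zero (mk I), ← mk_mul, zero_mul]
  mul_zero x := by
    obtain ⟨a, rfl⟩ := mk_surjective x
    rw [← map_zero (mk I), ← mk_mul, mul_zero]
  mul_assoc x y z := by
    obtain ⟨a, rfl⟩ := mk_surjective x
    obtain ⟨b, rfl⟩ := mk_surjective y
    obtain ⟨c, rfl⟩ := mk_surjective z
    simp only [← mk_mul, mul_assoc]
  norm_mul_le x y := by
    have h : ∀ δ > 0, ‖x * y‖ ≤ (‖x‖ + δ) * (‖y‖ + δ) := fun δ hδ => by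
      obtain ⟨a, rfl, ha⟩ := exists_norm_lt x hδ
      obtain ⟨b, rfl, hb⟩ := exists_norm_lt y hδ
      rw [← mk_mul]
      exact (norm_mk_le _).trans ((norm_mul_le _ _).trans (by gcongr))
    have hc : Filter.Tendsto (fun δ : ℝ => (‖x‖ + δ) * (‖y‖ + δ)) (nhdsWithin 0 (Set.Ioi 0))
        (nhds (‖x‖ * ‖y‖)) := by
      refine Filter.Tendsto.mono_left ?_ nhdsWithin_le_nhds
      have : Continuous fun δ : ℝ => (‖x‖ + δ) * (‖y‖ + δ) := by fun_prop
      simpa using this.tendsto 0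
    exact ge_of_tendsto hc (Filter.eventually_of_mem self_mem_nhdsWithin h)

instance : StarRing (CStarQuotient I) where
  star_involutive x := by
    obtain ⟨a, rfl⟩ := mk_surjective x
    simp only [← mk_star, star_star]
  star_mul x y := by
    obtain ⟨a, rfl⟩ := mk_surjective x
    obtain ⟨b, rfl⟩ := mk_surjective y
    simp only [← mk_star, ← mk_mul, star_mul]
  star_add x y := by
    obtain ⟨a, rfl⟩ := mk_surjective x
    obtain ⟨b, rfl⟩ := mk_surjective y
    simp only [← mk_star, ← map_add, star_add]

instance : CStarRing (CStarQuotient I) where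
  norm_mul_self_le x := by
    obtain ⟨a, rfl⟩ := mk_surjective x
    refine le_of_forall_pos_le_add fun δ hδ => ?_
    obtain ⟨m, hm, hlt⟩ := exists_norm_lt (star (mk I a) * mk I a) (half_pos hδ)
    have hj : m - star a * a ∈ I := mk_eq_mk.1 hm
    set j := m - star a * a with hjdef
    obtain ⟨u, w, huw, hus, hu, hux⟩ := exists_local_unit j (half_pos hδ)
    have huI : u ∈ I := huw ▸ I.mul_mem_right _ w (I.mul_mem_left _ _ hj)
    have hul : ∀ z : A, ‖z - u * z‖ ≤ ‖z‖ := fun z => by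
      have := hux (star z)
      rwa [← norm_star, star_sub, star_mul, star_star, hus.star_eq, norm_star z] at this
    have h1 : ‖mk I a‖ ≤ ‖a - a * u‖ := by
      have : mk I a = mk I (a - a * u) := mk_eq_mk.2 (by
        rw [sub_sub_cancel]; exact I.mul_mem_left _ _ huI)
      rw [this]
      exact norm_mk_le _
    have h2 : star (a - a * u) * (a - a * u)
        = ((m - m * u) - u * (m - m * u)) - ((j - j * u) - u * (j - j * u)) := by
      rw [hjdef, star_sub, star_mul, hus.star_eq]
      noncomm_ring
    calc ‖mk I a‖ * ‖mk I a‖ ≤ ‖a - a * u‖ * ‖a - a * u‖ := by gcongr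
      _ = ‖star (a - a * u) * (a - a * u)‖ := CStarRing.norm_star_mul_self.symm
      _ ≤ ‖(m - m * u) - u * (m - m * u)‖ + ‖(j - j * u) - u * (j - j * u)‖ := by
        rw [h2]; exact norm_sub_le _ _
      _ ≤ ‖m‖ + δ / 2 := add_le_add ((hul _).trans (hux m)) ((hul _).trans hu)
      _ ≤ ‖star (mk I a) * mk I a‖ + δ := by linarith

instance : NonUnitalCStarAlgebra (CStarQuotient I) where
  smul_assoc z x y := by
    obtain ⟨a, rfl⟩ := mk_surjective x
    obtain ⟨b, rfl⟩ := mk_surjective y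
    simp only [smul_eq_mul, ← map_smul, ← mk_mul, smul_mul_assoc]
  smul_comm z x y := by
    obtain ⟨a, rfl⟩ := mk_surjective x
    obtain ⟨b, rfl⟩ := mk_surjective y
    simp only [smul_eq_mul, ← map_smul, ← mk_mul, mul_smul_comm]
  star_smul z x := by
    obtain ⟨a, rfl⟩ := mk_surjective x
    simp only [← mk_star, ← map_smul, star_smul]

end CStarQuotient

end Ideal

/-! ### Nowhere scattered C⋆-algebras -/

/-- A minimal open projection in a C⋆-algebra `A` is a nonzero projection `p ∈ A` such that
`p A p = ℂ p`. -/
structure IsMinimalOpenProjection {A : Type*} [NonUnitalCStarAlgebra A] (p : A) : Prop where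
  isStarProjection : IsStarProjection p
  ne_zero : p ≠ 0
  corner_eq : (Set.range fun a : A => p * a * p) = Set.range fun z : ℂ => z • p

/-- A C⋆-algebra is nowhere scattered if none of its quotients contains a minimal open
projection. -/
def NowhereScattered (A : Type*) [NonUnitalCStarAlgebra A] : Prop :=
  ∀ (I : TwoSidedIdeal A) [IsClosed (I : Set A)],
    ¬ ∃ p : CStarQuotient I, IsMinimalOpenProjection p

/-- A sub-C⋆-algebra `B ⊆ A` is hereditary if `0 ≤ a ≤ b` with `b ∈ B` implies `a ∈ B`. -/
def NonUnitalStarSubalgebra.IsHereditary {A : Type*} [NonUnitalCStarAlgebra A] [PartialOrder A]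
    [StarOrderedRing A] (B : NonUnitalStarSubalgebra ℂ A) : Prop :=
  ∀ ⦃a b : A⦄, 0 ≤ a → a ≤ b → b ∈ B → a ∈ B

/-- A family of sub-C⋆-algebras approximates `A` if every finite subset of `A` is, up to any
`ε > 0`, contained in some member of the family. -/
def ApproximatesCStar {A : Type*} [NonUnitalCStarAlgebra A] {ι : Type*}
    (B : ι → NonUnitalStarSubalgebra ℂ A) : Prop :=
  ∀ (F : Finset A) (ε : ℝ), 0 < ε → ∃ i, ∀ a ∈ F, ∃ b ∈ B i, ‖a - b‖ < ε

/-- The C⋆-algebra `L`, with the ⋆-homomorphisms `g i : A i → L`, is an inductive limit (the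
colimit in the category of C⋆-algebras and ⋆-homomorphisms) of the system of C⋆-algebras `A i`
with connecting morphisms `f i j : A i → A j`. -/
structure IsCStarInductiveLimit {ι : Type u} [Preorder ι] {A : ι → Type v}
    [∀ i, NonUnitalCStarAlgebra (A i)] (f : ∀ i j, i ≤ j → A i →⋆ₙₐ[ℂ] A j)
    {L : Type (max u v)} [NonUnitalCStarAlgebra L] (g : ∀ i, A i →⋆ₙₐ[ℂ] L) : Prop where
  comp_eq : ∀ i j (h : i ≤ j), (g j).comp (f i j h) = g i
  existsUnique_desc : ∀ (C : Type (max u v)) [NonUnitalCStarAlgebra C]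
    (k : ∀ i, A i →⋆ₙₐ[ℂ] C), (∀ i j (h : i ≤ j), (k j).comp (f i j h) = k i) →
      ∃! φ : L →⋆ₙₐ[ℂ] C, ∀ i, φ.comp (g i) = k i

end

/-!
Everything rests on two facts about minimal projections.

*Minimality is stable under perturbation and lives in subalgebras.* If `p` is a minimal projection
and `q` is a projection close to `p`, then `q` is minimal, as `q p q` is a nonzero multiple of `q`
(`IsMinimalOpenProjection.of_norm_sub_le`). Suppose that `A / I` has a minimal projection `p`, and
that a lift of `p` is approximated by an element in the image of a ⋆-homomorphism `φ : B → A`. With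
`J` the kernel of `B → A / I`, the algebra `B / J` embeds isometrically into `A / I` and contains an
element close to `p`; functional calculus turns it into a projection of `B / J` close to `p`, which
is minimal in `A / I` and hence in `B / J`. So `B` is not nowhere scattered
(`NowhereScattered.of_forall_exists_norm_sub_lt`). This covers quotients (`φ` is the quotient map),
approximating families (`φ` are inclusions), and inductive limits (`φ` are the canonical maps, whose
images are jointly dense by the universal property, `IsCStarInductiveLimit.exists_norm_sub_lt`).

*Minimality in `B / J` passes to `A` when `B A B ⊆ B`.* This condition holds for hereditary
subalgebras and for ideals. It allows an ideal `J` of `B` to be written as `I ∩ B` for an ideal `I`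
of `A` (`TwoSidedIdeal.coe_mem_largestExtension`), so that `B / J` sits inside `A / I`. If `p` is a
projection of `B / J`, then `p (A / I) p` is contained in `B / J`, and so `p` is minimal in `A / I`
if it is in `B / J` (`NowhereScattered.of_mul_mul_mem`).
-/

/-! ### Minimal projections -/

section MinimalProjections

variable {A : Type*} [NonUnitalCStarAlgebra A]

theorem isMinimalOpenProjection_iff_exists_smul {p : A} :
    IsMinimalOpenProjection p ↔
      IsStarProjection p ∧ p ≠ 0 ∧ ∀ a : A, ∃ z : ℂ, p * a * p = z • p := by
  constructor
  · rintro ⟨hp, h0, h⟩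
    refine ⟨hp, h0, fun a => ?_⟩
    obtain ⟨z, hz⟩ := h.subset ⟨a, rfl⟩
    exact ⟨z, hz.symm⟩
  · rintro ⟨hp, h0, h⟩
    refine ⟨hp, h0, Set.Subset.antisymm ?_ ?_⟩
    · rintro _ ⟨a, rfl⟩
      obtain ⟨z, hz⟩ := h a
      exact ⟨z, hz.symm⟩
    · rintro _ ⟨z, rfl⟩
      refine ⟨z • p, ?_⟩
      simp only [mul_smul_comm, smul_mul_assoc, hp.isIdempotentElem.eq]

theorem IsStarProjection.norm_le_one_of_nonUnital {p : A} (hp : IsStarProjection p) :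
    ‖p‖ ≤ 1 := by
  have h : ‖p‖ * ‖p‖ = ‖p‖ := by
    rw [← CStarRing.norm_star_mul_self, hp.isSelfAdjoint.star_eq, hp.isIdempotentElem.eq]
  nlinarith [norm_nonneg p]

theorem IsIdempotentElem.eq_zero_of_norm_lt_one {x : A} (hx : IsIdempotentElem x)
    (h : ‖x‖ < 1) : x = 0 := by
  have h1 : ‖x‖ ≤ ‖x‖ * ‖x‖ := by
    conv_lhs => rw [← hx.eq]
    exact norm_mul_le x x
  exact norm_eq_zero.1 (by nlinarith [norm_nonneg x])

/-- Minimality is stable under small perturbations. If `p q p = t p`, then `t⁻¹ q p q` is an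
idempotent below `q` that is close to `q`, hence equal to it; so `q A q` is contained in
`q p A p q = ℂ q p q = ℂ q`. -/
theorem IsMinimalOpenProjection.of_norm_sub_le {p q : A} (hp : IsMinimalOpenProjection p)
    (hq : IsStarProjection q) (h : ‖p - q‖ ≤ 1 / 4) : IsMinimalOpenProjection q := by
  obtain ⟨hpp, hp0, hc⟩ := isMinimalOpenProjection_iff_exists_smul.1 hp
  have pp := hpp.isIdempotentElem.eq
  have qq := hq.isIdempotentElem.eq
  have np := hpp.norm_le_one_of_nonUnital
  have nq := hq.norm_le_one_of_nonUnital
  have np1 : ‖p‖ = 1 := by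
    by_contra hne
    exact hp0 (hpp.isIdempotentElem.eq_zero_of_norm_lt_one (lt_of_le_of_ne np hne))
  have compress : ∀ r x : A, ‖r‖ ≤ 1 → ‖x‖ ≤ 1 / 4 → ‖r * x * r‖ ≤ 1 / 4 := fun r x hr hx =>
    calc ‖r * x * r‖ ≤ ‖r‖ * ‖x‖ * ‖r‖ := norm_mul₃_le
      _ ≤ 1 * (1 / 4) * 1 := by gcongr
      _ = 1 / 4 := by norm_num
  obtain ⟨t, ht⟩ := hc q
  have ht1 : ‖1 - t‖ ≤ 1 / 4 := by
    have h1 : (1 - t) • p = p * (p - q) * p := by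
      rw [mul_sub, sub_mul, ht, pp, pp, sub_smul, one_smul]
    have h2 := compress p (p - q) np h
    rwa [← h1, norm_smul, np1, mul_one] at h2
  have ht2 : 3 / 4 ≤ ‖t‖ := by
    have := norm_sub_norm_le (1 : ℂ) t
    rw [norm_one] at this
    linarith
  have ht0 : t ≠ 0 := by
    rintro rfl
    norm_num at ht2
  have hqq : q * (q - p) * q = q - q * p * q := by
    rw [mul_sub, sub_mul, qq, qq]
  have hq1 : ‖q - q * p * q‖ ≤ 1 / 4 := by
    rw [← hqq]
    exact compress q _ nq (by rwa [norm_sub_rev])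
  set e := t⁻¹ • (q * p * q) with he
  have hsq : q * p * q * (q * p * q) = t • (q * p * q) := by
    calc q * p * q * (q * p * q) = q * (p * (q * q) * p) * q := by noncomm_ring
      _ = t • (q * p * q) := by rw [qq, ht, mul_smul_comm, smul_mul_assoc]
  have hee : e * e = e := by
    rw [he, smul_mul_smul_comm, hsq, smul_smul, mul_assoc, inv_mul_cancel₀ ht0, mul_one]
  have hqe : q * e = e := by
    rw [he, mul_smul_comm, ← mul_assoc, ← mul_assoc, qq]
  have heq : e * q = e := by
    rw [he, smul_mul_assoc, mul_assoc (q * p), qq]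
  have hid : IsIdempotentElem (q - e) := by
    rw [IsIdempotentElem, sub_mul, mul_sub, mul_sub, qq, hqe, heq, hee, sub_self, sub_zero]
  have hlt : ‖q - e‖ < 1 := by
    have h1 : q - e = t⁻¹ • ((q - q * p * q) - (1 - t) • q) := by
      have h2 : (q - q * p * q) - (1 - t) • q = t • q - q * p * q := by
        rw [sub_smul, one_smul]
        abel
      rw [h2, smul_sub, smul_smul, inv_mul_cancel₀ ht0, one_smul]
    have h3 : ‖(q - q * p * q) - (1 - t) • q‖ ≤ 1 / 2 := by
      refine (norm_sub_le _ _).trans ?_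
      rw [norm_smul]
      nlinarith [norm_nonneg q, norm_nonneg (1 - t)]
    rw [h1, norm_smul, norm_inv, inv_mul_lt_iff₀ (by linarith)]
    linarith
  have hqe' : q = e := sub_eq_zero.1 (hid.eq_zero_of_norm_lt_one hlt)
  refine isMinimalOpenProjection_iff_exists_smul.2 ⟨hq, ?_, fun a => ?_⟩
  · rintro rfl
    rw [sub_zero, np1] at h
    norm_num at h
  · obtain ⟨z, hz⟩ := hc (q * a * q)
    have hqpq : q * p * q = t • q := by
      conv_rhs => rw [hqe', he, smul_smul, mul_inv_cancel₀ ht0, one_smul]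
    refine ⟨t⁻¹ * (t⁻¹ * (z * t)), ?_⟩
    calc q * a * q = e * a * e := by rw [← hqe']
      _ = t⁻¹ • t⁻¹ • (q * (p * (q * a * q) * p) * q) := by
        rw [he]
        simp only [smul_mul_assoc, mul_smul_comm, mul_assoc]
      _ = _ := by
        rw [hz, mul_smul_comm, smul_mul_assoc, hqpq]
        simp only [smul_smul]

/-- A self-adjoint element that is almost idempotent is close to a projection: its spectrum is
concentrated near `0` and `1`, so a continuous step function applied to it gives a projection. -/
theorem IsSelfAdjoint.exists_isStarProjection_norm_sub_le {s : A} (hs : IsSelfAdjoint s)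
    (h : ‖s * s - s‖ ≤ 1 / 10) : ∃ q : A, IsStarProjection q ∧ ‖q - s‖ ≤ 1 / 5 := by
  let f : ℝ → ℝ := fun x => max 0 (min 1 (2 * x - 1 / 2))
  have hf : Continuous f := by fun_prop
  have hf0 : f 0 = 0 := by norm_num [f]
  have hpoly : cfcₙ (fun x : ℝ => x * x - x) s = s * s - s := by
    rw [cfcₙ_sub (fun x : ℝ => x * x) (fun x => x) s (by fun_prop) (by simp) (by fun_prop) rfl,
      cfcₙ_mul (fun x : ℝ => x) (fun x => x) s (by fun_prop) rfl (by fun_prop) rfl,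
      cfcₙ_id' ℝ s]
  have hspec : ∀ x ∈ quasispectrum ℝ s, |x * x - x| ≤ 1 / 10 := by
    rw [← hpoly] at h
    exact (norm_cfcₙ_le_iff (fun x : ℝ => x * x - x) s (1 / 10)
      (by fun_prop) (by simp) hs).1 h
  have key : ∀ x ∈ quasispectrum ℝ s, f x * f x = f x ∧ |f x - x| ≤ 1 / 5 := by
    intro x hx
    obtain ⟨h1, h2⟩ := abs_le.1 (hspec x hx)
    -- `|x² - x| = 3 / 16` at `x = 1 / 4` and `x = 3 / 4`, so the spectrum avoids `[1 / 4, 3 / 4]`.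
    rcases lt_or_ge x (1 / 2) with hlt | hge
    · have hx4 : x < 1 / 4 := by nlinarith
      have : f x = 0 := max_eq_left ((min_le_right _ _).trans (by linarith))
      rw [this, abs_le]
      refine ⟨by norm_num, ?_, ?_⟩ <;> nlinarith
    · have hx4 : 3 / 4 < x := by nlinarith
      have : f x = 1 := by
        simp only [f]
        rw [min_eq_left (by linarith), max_eq_right zero_le_one]
      rw [this, abs_le]
      refine ⟨by norm_num, ?_, ?_⟩ <;> nlinarith
  refine ⟨cfcₙ f s, ⟨?_, cfcₙ_predicate f s⟩, ?_⟩
  · rw [IsIdempotentElem, ← cfcₙ_mul f f s hf.continuousOn hf0 hf.continuousOn hf0]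
    exact cfcₙ_congr fun x hx => (key x hx).1
  · have : cfcₙ f s - s = cfcₙ (fun x => f x - x) s := by
      rw [cfcₙ_sub f (fun x => x) s hf.continuousOn hf0 (by fun_prop) rfl, cfcₙ_id' ℝ s]
    rw [this]
    exact norm_cfcₙ_le fun x hx => (key x hx).2

end MinimalProjections

/-! ### Homomorphisms out of quotients -/

namespace CStarQuotient

variable {A : Type*} [NonUnitalCStarAlgebra A]

theorem mk_eq_zero {I : TwoSidedIdeal A} [IsClosed (I : Set A)] {a : A} :
    mk I a = 0 ↔ a ∈ I := by
  rw [← map_zero (mk I), mk_eq_mk, sub_zero]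

/-- The quotient map `A → A / I` as a ⋆-homomorphism. -/
noncomputable def mkHom (I : TwoSidedIdeal A) [IsClosed (I : Set A)] :
    A →⋆ₙₐ[ℂ] CStarQuotient I where
  toFun := mk I
  map_smul' := map_smul (mk I)
  map_zero' := map_zero (mk I)
  map_add' := map_add (mk I)
  map_mul' := mk_mul
  map_star' := mk_star

end CStarQuotient

section KernelLift

variable {A B : Type*} [NonUnitalCStarAlgebra A] [NonUnitalCStarAlgebra B]

instance NonUnitalStarAlgHom.isClosed_ker (φ : B →⋆ₙₐ[ℂ] A) :
    IsClosed (TwoSidedIdeal.ker φ : Set B) := by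
  have hφ : Continuous φ :=
    AddMonoidHomClass.continuous_of_bound φ 1 fun b => by
      simpa only [one_mul] using NonUnitalStarAlgHom.norm_apply_le φ b
  have : (TwoSidedIdeal.ker φ : Set B) = φ ⁻¹' {0} := by
    ext b
    exact TwoSidedIdeal.mem_ker φ
  rw [this]
  exact isClosed_singleton.preimage hφ

/-- The ⋆-homomorphism `B / ker φ → A` induced by `φ : B → A`. -/
noncomputable def NonUnitalStarAlgHom.kerLift (φ : B →⋆ₙₐ[ℂ] A) :
    CStarQuotient (TwoSidedIdeal.ker φ) →⋆ₙₐ[ℂ] A where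
  toFun := Quotient.lift φ fun a b h => by
    have h : a - b ∈ TwoSidedIdeal.ker φ := (Submodule.quotientRel_def _).1 h
    rwa [TwoSidedIdeal.mem_ker, map_sub, sub_eq_zero] at h
  map_smul' z x := by
    obtain ⟨a, rfl⟩ := CStarQuotient.mk_surjective x
    exact map_smul φ z a
  map_zero' := map_zero φ
  map_add' x y := by
    obtain ⟨a, rfl⟩ := CStarQuotient.mk_surjective x
    obtain ⟨b, rfl⟩ := CStarQuotient.mk_surjective y
    exact map_add φ a b
  map_mul' x y := by
    obtain ⟨a, rfl⟩ := CStarQuotient.mk_surjective x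
    obtain ⟨b, rfl⟩ := CStarQuotient.mk_surjective y
    exact map_mul φ a b
  map_star' x := by
    obtain ⟨a, rfl⟩ := CStarQuotient.mk_surjective x
    exact map_star φ a

theorem NonUnitalStarAlgHom.kerLift_injective (φ : B →⋆ₙₐ[ℂ] A) :
    Function.Injective φ.kerLift := by
  refine (injective_iff_map_eq_zero _).2 fun x hx => ?_
  obtain ⟨a, rfl⟩ := CStarQuotient.mk_surjective x
  exact CStarQuotient.mk_eq_zero.2 ((TwoSidedIdeal.mem_ker φ).2 hx)

/-- Minimal projections can be pulled back along injective ⋆-homomorphisms. -/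
theorem IsMinimalOpenProjection.of_injective {φ : B →⋆ₙₐ[ℂ] A} (hφ : Function.Injective φ)
    {q : B} (h : IsMinimalOpenProjection (φ q)) : IsMinimalOpenProjection q := by
  obtain ⟨⟨h1, h2⟩, h0, hc⟩ := isMinimalOpenProjection_iff_exists_smul.1 h
  refine isMinimalOpenProjection_iff_exists_smul.2 ⟨⟨hφ ?_, hφ ?_⟩, ?_, fun a => ?_⟩
  · rw [map_mul, h1.eq]
  · rw [map_star, h2.star_eq]
  · rintro rfl
    exact h0 (map_zero φ)
  · obtain ⟨z, hz⟩ := hc (φ a)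
    exact ⟨z, hφ (by rw [map_mul, map_mul, map_smul, hz])⟩

/-- If a minimal projection `p` of `A` can be approximated from an isometrically embedded
C⋆-algebra `B`, then functional calculus in `B` yields a projection close to `p`, which is again
minimal. -/
theorem exists_isMinimalOpenProjection_of_injective_of_norm_sub_le {φ : B →⋆ₙₐ[ℂ] A}
    (hφ : Function.Injective φ) {p : A} (hp : IsMinimalOpenProjection p) {c : B}
    (hc : ‖φ c - p‖ ≤ 1 / 40) : ∃ q : B, IsMinimalOpenProjection q := by
  have hiso : ∀ b : B, ‖φ b‖ = ‖b‖ := NonUnitalStarAlgHom.norm_map φ hφ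
  have pp := hp.isStarProjection.isIdempotentElem.eq
  have ps := hp.isStarProjection.isSelfAdjoint.star_eq
  have np := hp.isStarProjection.norm_le_one_of_nonUnital
  -- With `‖φ s - p‖ ≤ 1 / 40`, the defect `‖s² - s‖` is below `1 / 10`, and the projection `q` is at
  -- distance at most `1 / 5 + 1 / 40 < 1 / 4` from `p`.
  set s : B := (1 / 2 : ℂ) • (c + star c) with hs
  have hss : IsSelfAdjoint s := by
    rw [IsSelfAdjoint, hs, star_smul, star_add, star_star, add_comm (star c)]
    congr 1
    simp
  set e : A := φ s - p with he
  have hes : e = (1 / 2 : ℂ) • ((φ c - p) + star (φ c - p)) := by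
    have h2 : p = (1 / 2 : ℂ) • (p + p) := by
      rw [← two_smul ℂ p, smul_smul]
      norm_num
    rw [he, hs, map_smul, map_add, map_star, star_sub, ps]
    conv_lhs => rw [h2]
    rw [← smul_sub]
    congr 1
    abel
  have hne : ‖e‖ ≤ 1 / 40 := by
    rw [hes, norm_smul]
    have h1 : ‖(φ c - p) + star (φ c - p)‖ ≤ 1 / 40 + 1 / 40 :=
      (norm_add_le _ _).trans (add_le_add hc (by rwa [norm_star]))
    have h2 : ‖(1 / 2 : ℂ)‖ = 1 / 2 := by norm_num
    rw [h2]
    linarith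
  have hidem : ‖s * s - s‖ ≤ 1 / 10 := by
    have h1 : φ (s * s - s) = p * e + e * p + e * e - e := by
      have h2 : φ s = p + e := by rw [he]; abel
      have h3 : (p + e) * (p + e) - (p + e) = (p * p - p) + (p * e + e * p + e * e - e) := by
        noncomm_ring
      rw [map_sub, map_mul, h2, h3, pp, sub_self, zero_add]
    rw [← hiso, h1]
    have n1 := norm_mul_le p e
    have n2 := norm_mul_le e p
    have n3 := norm_mul_le e e
    have n4 := norm_sub_le (p * e + e * p + e * e) e
    have n5 := norm_add₃_le (a := p * e) (b := e * p) (c := e * e)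
    nlinarith [norm_nonneg e, norm_nonneg p]
  obtain ⟨q, hq, hqs⟩ := hss.exists_isStarProjection_norm_sub_le hidem
  refine ⟨q, IsMinimalOpenProjection.of_injective hφ (hp.of_norm_sub_le ⟨?_, ?_⟩ ?_)⟩
  · rw [IsIdempotentElem, ← map_mul, hq.isIdempotentElem.eq]
  · rw [IsSelfAdjoint, ← map_star, hq.isSelfAdjoint.star_eq]
  · have h1 : p - φ q = -(e + φ (q - s)) := by
      rw [he, map_sub]
      abel
    rw [h1, norm_neg]
    refine (norm_add_le _ _).trans ?_
    rw [hiso]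
    linarith

end KernelLift

/-! ### Approximation by images of nowhere scattered C⋆-algebras -/

/-- If every element of `A` can be approximated by elements in images of nowhere scattered
C⋆-algebras under ⋆-homomorphisms, then `A` is nowhere scattered. The approximation of single
elements is enough, since a single minimal projection has to be perturbed. -/
theorem NowhereScattered.of_forall_exists_norm_sub_lt {ι : Type*} {B : ι → Type*}
    [∀ i, NonUnitalCStarAlgebra (B i)] {A : Type*} [NonUnitalCStarAlgebra A]
    (φ : ∀ i, B i →⋆ₙₐ[ℂ] A) (hB : ∀ i, NowhereScattered (B i))
    (h : ∀ (a : A) (ε : ℝ), 0 < ε → ∃ i, ∃ b : B i, ‖φ i b - a‖ < ε) :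
    NowhereScattered A := by
  rintro I _ ⟨p, hp⟩
  obtain ⟨a, rfl⟩ := CStarQuotient.mk_surjective p
  obtain ⟨i, b, hb⟩ := h a (1 / 40) (by norm_num)
  let ψ := (CStarQuotient.mkHom I).comp (φ i)
  refine hB i (TwoSidedIdeal.ker ψ) (exists_isMinimalOpenProjection_of_injective_of_norm_sub_le
    ψ.kerLift_injective hp (c := CStarQuotient.mk _ b) ?_)
  have h1 : ψ.kerLift (CStarQuotient.mk _ b) - CStarQuotient.mk I a
      = CStarQuotient.mk I (φ i b - a) := (map_sub (CStarQuotient.mk I) _ _).symm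
  rw [h1]
  exact (CStarQuotient.norm_mk_le _).trans hb.le

theorem NowhereScattered.quotient {A : Type*} [NonUnitalCStarAlgebra A] (hA : NowhereScattered A)
    (I : TwoSidedIdeal A) [IsClosed (I : Set A)] : NowhereScattered (CStarQuotient I) := by
  refine .of_forall_exists_norm_sub_lt (ι := Unit) (fun _ => CStarQuotient.mkHom I)
    (fun _ => hA) fun x ε hε => ?_
  obtain ⟨a, rfl⟩ := CStarQuotient.mk_surjective x
  refine ⟨(), a, ?_⟩
  have : CStarQuotient.mkHom I a = CStarQuotient.mk I a := rfl
  rwa [this, sub_self, norm_zero]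

theorem NowhereScattered.of_approximatesCStar {A : Type*} [NonUnitalCStarAlgebra A] {ι : Type*}
    {B : ι → NonUnitalStarSubalgebra ℂ A} [∀ i, IsClosed (B i : Set A)]
    (hB : ∀ i, NowhereScattered (B i)) (h : ApproximatesCStar B) : NowhereScattered A := by
  refine .of_forall_exists_norm_sub_lt
    (fun i => NonUnitalStarSubalgebraClass.subtype (B i)) hB fun a ε hε => ?_
  obtain ⟨i, hi⟩ := h {a} ε hε
  obtain ⟨b, hb, hab⟩ := hi a (Finset.mem_singleton_self a)
  exact ⟨i, ⟨b, hb⟩, by rwa [norm_sub_rev]⟩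

/-! ### Hereditary sub-C⋆-algebras and ideals -/

section Hereditary

variable {A : Type*} [NonUnitalCStarAlgebra A]

/-- A hereditary sub-C⋆-algebra `B` satisfies `B A B ⊆ B`: for positive `a`, the element
`b⋆ a b ≤ ‖a‖ b⋆ b` belongs to `B`; the general case follows by polarization, and as the positive
elements span `A`. -/
theorem NonUnitalStarSubalgebra.IsHereditary.mul_mul_mem [PartialOrder A] [StarOrderedRing A]
    {B : NonUnitalStarSubalgebra ℂ A} (hB : B.IsHereditary) {b c : A} (hb : b ∈ B) (hc : c ∈ B)
    (a : A) : b * a * c ∈ B := by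
  have pos : ∀ x : A, 0 ≤ x → ∀ y ∈ B, star y * x * y ∈ B := fun x hx y hy =>
    hB (star_left_conjugate_nonneg hx y)
      (CStarAlgebra.star_left_conjugate_le_norm_smul (IsSelfAdjoint.of_nonneg hx))
      (by
        rw [← Complex.coe_smul]
        exact SMulMemClass.smul_mem _ (mul_mem (star_mem hy) hy))
  have ha : a ∈ Submodule.span ℂ {x : A | 0 ≤ x} := by
    rw [CStarAlgebra.span_nonneg]
    trivial
  induction ha using Submodule.span_induction with
  | mem x hx =>
    have polarization : b * x * c = (1 / 4 : ℂ) •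
        ((star (star b + c) * x * (star b + c) - star (star b - c) * x * (star b - c))
        + Complex.I • (star (star b - Complex.I • c) * x * (star b - Complex.I • c)
          - star (star b + Complex.I • c) * x * (star b + Complex.I • c))) := by
      have hstar : star Complex.I = -Complex.I := Complex.conj_I
      simp only [star_add, star_sub, star_star, star_smul, hstar, add_mul, mul_add, sub_mul,
        mul_sub, smul_mul_assoc, mul_smul_comm, smul_add, smul_sub, smul_smul, neg_smul, neg_mul,
        smul_neg, Complex.I_mul_I]
      module
    rw [polarization]
    have hI : Complex.I • c ∈ B := SMulMemClass.smul_mem _ hc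
    exact SMulMemClass.smul_mem _ (add_mem
      (sub_mem (pos x hx _ (add_mem (star_mem hb) hc)) (pos x hx _ (sub_mem (star_mem hb) hc)))
      (SMulMemClass.smul_mem _ (sub_mem (pos x hx _ (sub_mem (star_mem hb) hI))
        (pos x hx _ (add_mem (star_mem hb) hI)))))
  | zero => simp
  | add x y _ _ hx hy => rw [mul_add, add_mul]; exact add_mem hx hy
  | smul z x _ hx => rw [mul_smul_comm, smul_mul_assoc]; exact SMulMemClass.smul_mem z hx

/-- For a sub-C⋆-algebra `B ⊆ A` with `B A B ⊆ B` and an ideal `J` of `B`, the ideal of all `x ∈ A`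
with `B A x A B ⊆ J`. If `J` is closed, it is the largest ideal of `A` that meets `B` in `J`. -/
def TwoSidedIdeal.largestExtension {B : NonUnitalStarSubalgebra ℂ A}
    (hB : ∀ b ∈ B, ∀ c ∈ B, ∀ a, b * a * c ∈ B) (J : TwoSidedIdeal B) : TwoSidedIdeal A :=
  .mk' {x | ∀ (b c : B) (a d : A), (⟨b * (a * x * d) * c, hB _ b.2 _ c.2 _⟩ : B) ∈ J}
    (fun b c a d => by
      convert J.zero_mem using 1
      ext
      simp)
    (fun {x y} hx hy b c a d => by
      convert J.add_mem (hx b c a d) (hy b c a d) using 1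
      ext
      simp only [NonUnitalStarSubalgebra.coe_add]
      noncomm_ring)
    (fun {x} hx b c a d => by
      convert J.neg_mem (hx b c a d) using 1
      ext
      simp only [NonUnitalStarSubalgebra.coe_neg]
      noncomm_ring)
    (fun {y x} hx b c a d => by
      convert hx b c (a * y) d using 2
      noncomm_ring)
    (fun {x y} hx b c a d => by
      convert hx b c a (y * d) using 2
      noncomm_ring)

namespace TwoSidedIdeal

variable {B : NonUnitalStarSubalgebra ℂ A} {hB : ∀ b ∈ B, ∀ c ∈ B, ∀ a, b * a * c ∈ B}
  {J : TwoSidedIdeal B}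

theorem mem_largestExtension {x : A} : x ∈ J.largestExtension hB ↔
    ∀ (b c : B) (a d : A), (⟨b * (a * x * d) * c, hB _ b.2 _ c.2 _⟩ : B) ∈ J :=
  TwoSidedIdeal.mem_mk' _ _ _ _ _ _ _

instance isClosed_largestExtension [hJ : IsClosed (J : Set B)] :
    IsClosed (J.largestExtension hB : Set A) := by
  have : (J.largestExtension hB : Set A) = ⋂ (b : B) (c : B) (a : A) (d : A),
      (fun x : A => (⟨b * (a * x * d) * c, hB _ b.2 _ c.2 _⟩ : B)) ⁻¹' (J : Set B) := by
    ext x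
    simp only [Set.mem_iInter]
    exact mem_largestExtension
  rw [this]
  refine isClosed_iInter fun b => isClosed_iInter fun c => isClosed_iInter fun a =>
    isClosed_iInter fun d => hJ.preimage ?_
  exact Continuous.subtype_mk (by fun_prop) _

/-- The largest extension of `J` meets `B` in `J`. That it contains `J` holds because every `j ∈ J`
is a limit of elements `j j⋆ (j w)`, so that `b a j d c` is a limit of products
`(b a j) j⋆ (j w d c)` with outer factors in `B`. Conversely, an element `y` of a C⋆-algebra
vanishes as soon as `(y⋆ y)⁴` does. -/
theorem coe_mem_largestExtension [IsClosed (B : Set A)] [hJ : IsClosed (J : Set B)] {x : B} :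
    (x : A) ∈ J.largestExtension hB ↔ x ∈ J := by
  constructor
  · intro hx
    -- The outer factors and the multipliers are chosen so that the product is `(x⋆ x)⁴`.
    have h1 := mem_largestExtension.1 hx (star x) x (x * star x : B) (star x * x * star x : B)
    have h2 : (star x * x * (star x * x)) * (star x * x * (star x * x)) ∈ J := by
      convert h1 using 1
      ext
      push_cast
      noncomm_ring
    rw [← CStarQuotient.mk_eq_zero] at h2 ⊢
    simp only [CStarQuotient.mk_mul, CStarQuotient.mk_star] at h2
    have zero_of_sq : ∀ y : CStarQuotient J, IsSelfAdjoint y → y * y = 0 → y = 0 :=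
      fun y hy h => CStarRing.star_mul_self_eq_zero_iff y |>.1 (by rwa [hy.star_eq])
    have hs : IsSelfAdjoint (star (CStarQuotient.mk J x) * CStarQuotient.mk J x) :=
      .star_mul_self _
    have hss : IsSelfAdjoint (star (CStarQuotient.mk J x) * CStarQuotient.mk J x *
        (star (CStarQuotient.mk J x) * CStarQuotient.mk J x)) := by
      rw [IsSelfAdjoint, star_mul, hs.star_eq]
    exact (CStarRing.star_mul_self_eq_zero_iff _).1 (zero_of_sq _ hs (zero_of_sq _ hss h2))
  · intro hx
    have hcl : (x : A) ∈ closure (J.largestExtension hB : Set A) := by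
      refine Metric.mem_closure_iff.2 fun ε hε => ?_
      obtain ⟨u, w, rfl, -, hu, -⟩ := exists_local_unit x (half_pos hε)
      refine ⟨(x * (star x * x * w) : B), mem_largestExtension.2 fun b c a d => ?_, ?_⟩
      · let l : B := ⟨b * a * x, hB _ b.2 _ x.2 _⟩
        let r : B := ⟨(x * w : B) * d * c, hB _ (x * w).2 _ c.2 _⟩
        convert J.mul_mem_right _ r (J.mul_mem_left l _ (J.star_mem_of_isClosed hx)) using 1
        ext
        push_cast
        simp only [l, r]
        push_cast
        noncomm_ring
      · rw [dist_eq_norm]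
        refine lt_of_le_of_lt (b := ε / 2) ?_ (by linarith)
        exact hu
    rwa [IsClosed.closure_eq isClosed_largestExtension] at hcl

end TwoSidedIdeal

/-- A sub-C⋆-algebra `B` with `B A B ⊆ B` inherits being nowhere scattered: if `I` is an ideal of
`A` that meets `B` in `J`, then the corner in `A / I` of a projection of `B / J ⊆ A / I` does not
leave `B / J`. -/
theorem NowhereScattered.of_mul_mul_mem (hA : NowhereScattered A)
    {B : NonUnitalStarSubalgebra ℂ A} [IsClosed (B : Set A)]
    (hB : ∀ b ∈ B, ∀ c ∈ B, ∀ a, b * a * c ∈ B) : NowhereScattered B := by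
  rintro J hJ ⟨p, hp⟩
  obtain ⟨b, rfl⟩ := CStarQuotient.mk_surjective p
  obtain ⟨⟨h1, h2⟩, h0, hc⟩ := isMinimalOpenProjection_iff_exists_smul.1 hp
  let I := J.largestExtension hB
  have transfer : ∀ {x y : B}, CStarQuotient.mk J x = CStarQuotient.mk J y →
      CStarQuotient.mk I (x : A) = CStarQuotient.mk I (y : A) := fun {x y} h => by
    rw [CStarQuotient.mk_eq_mk] at h ⊢
    exact TwoSidedIdeal.coe_mem_largestExtension.2 h
  have hidem : CStarQuotient.mk I (b : A) * CStarQuotient.mk I b = CStarQuotient.mk I b :=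
    transfer (x := b * b) h1
  refine hA I ⟨CStarQuotient.mk I b, isMinimalOpenProjection_iff_exists_smul.2
    ⟨⟨hidem, transfer (x := star b) h2⟩, fun h => h0 ?_, fun x => ?_⟩⟩
  · rw [CStarQuotient.mk_eq_zero] at h ⊢
    exact TwoSidedIdeal.coe_mem_largestExtension.1 h
  · obtain ⟨a, rfl⟩ := CStarQuotient.mk_surjective x
    let m : B := ⟨b * a * b, hB _ b.2 _ b.2 _⟩
    obtain ⟨z, hz⟩ := hc (CStarQuotient.mk J m)
    refine ⟨z, ?_⟩
    have h3 : CStarQuotient.mk I (b * (b * a * b) * b : A) = CStarQuotient.mk I (z • (b : A)) :=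
      transfer (x := b * m * b) (y := z • b) hz
    rw [map_smul] at h3
    rw [← h3]
    simp only [CStarQuotient.mk_mul, mul_assoc, hidem]
    simp only [← mul_assoc, hidem]

end Hereditary

/-! ### Inductive limits -/

/-- The images of the C⋆-algebras of an inductive system are jointly dense in the inductive limit:
the closure of their union is a sub-C⋆-algebra `M`, and by the universal property, the identity
factors through `M`. -/
theorem IsCStarInductiveLimit.exists_norm_sub_lt {ι : Type u} [Preorder ι] [IsDirectedOrder ι]
    [Nonempty ι] {A : ι → Type v} [∀ i, NonUnitalCStarAlgebra (A i)]
    {f : ∀ i j, i ≤ j → A i →⋆ₙₐ[ℂ] A j} {L : Type (max u v)} [NonUnitalCStarAlgebra L]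
    {g : ∀ i, A i →⋆ₙₐ[ℂ] L} (h : IsCStarInductiveLimit f g) (x : L) {ε : ℝ} (hε : 0 < ε) :
    ∃ i, ∃ a : A i, ‖g i a - x‖ < ε := by
  let R : ι → NonUnitalStarSubalgebra ℂ L := fun i => NonUnitalStarAlgHom.range (g i)
  have hmono : Monotone R := fun i j hij => by
    rintro _ ⟨a, rfl⟩
    exact ⟨f i j hij a, DFunLike.congr_fun (h.comp_eq i j hij) a⟩
  let M := (⨆ i, R i).topologicalClosure
  have : IsClosed (M : Set L) := (⨆ i, R i).isClosed_topologicalClosure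
  have hgM : ∀ i a, g i a ∈ M := fun i a =>
    (⨆ i, R i).le_topologicalClosure (le_iSup R i ⟨a, rfl⟩)
  let k : ∀ i, A i →⋆ₙₐ[ℂ] M := fun i => NonUnitalStarAlgHom.codRestrict (g i) M (hgM i)
  obtain ⟨φ, hφ, -⟩ := h.existsUnique_desc M k fun i j hij => by
    ext a
    exact DFunLike.congr_fun (h.comp_eq i j hij) a
  have hid : (NonUnitalStarSubalgebraClass.subtype M).comp φ = NonUnitalStarAlgHom.id ℂ L :=
    (h.existsUnique_desc L g h.comp_eq).unique
      (fun i => by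
        ext a
        exact congrArg Subtype.val (DFunLike.congr_fun (hφ i) a))
      (fun i => by
        ext a
        rfl)
  have hx : x ∈ closure (⋃ i, (R i : Set L)) := by
    rw [← NonUnitalStarSubalgebra.coe_iSup_of_directed hmono.directed_le]
    have hxM : ((φ x : M) : L) = x := DFunLike.congr_fun hid x
    rw [← hxM]
    exact (φ x).2
  obtain ⟨y, hy, hxy⟩ := Metric.mem_closure_iff.1 hx ε hε
  obtain ⟨i, a, rfl⟩ := Set.mem_iUnion.1 hy
  exact ⟨i, a, by rwa [dist_comm, dist_eq_norm] at hxy⟩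

theorem mainTheorem9 :
    -- quotients, hereditary sub-C⋆-algebras, and ideals
    (∀ (A : Type u) [NonUnitalCStarAlgebra A] [PartialOrder A] [StarOrderedRing A],
      NowhereScattered A →
        (∀ (I : TwoSidedIdeal A) [IsClosed (I : Set A)], NowhereScattered (CStarQuotient I)) ∧
        (∀ (B : NonUnitalStarSubalgebra ℂ A) [IsClosed (B : Set A)],
          B.IsHereditary → NowhereScattered B) ∧
        (∀ (I : TwoSidedIdeal A) [IsClosed (I : Set A)], NowhereScattered I.toSubCStar)) ∧
    -- approximation by nowhere scattered sub-C⋆-algebras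
    (∀ (A : Type u) [NonUnitalCStarAlgebra A] (Λ : Type v)
      (B : Λ → NonUnitalStarSubalgebra ℂ A) [∀ i, IsClosed (B i : Set A)],
      (∀ i, NowhereScattered (B i)) → ApproximatesCStar B → NowhereScattered A) ∧
    -- inductive limits
    (∀ (Λ : Type u) [Preorder Λ] [IsDirectedOrder Λ] [Nonempty Λ] (A : Λ → Type v)
      [∀ i, NonUnitalCStarAlgebra (A i)] (f : ∀ i j, i ≤ j → A i →⋆ₙₐ[ℂ] A j)
      [DirectedSystem A fun i j h => f i j h]
      (L : Type (max u v)) [NonUnitalCStarAlgebra L] (g : ∀ i, A i →⋆ₙₐ[ℂ] L),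
      (∀ i, NowhereScattered (A i)) → IsCStarInductiveLimit f g → NowhereScattered L) := by
  refine ⟨fun A _ _ _ hA => ⟨fun I _ => hA.quotient I, fun B _ hB => ?_, fun I _ => ?_⟩,
    fun A _ Λ B _ hB h => .of_approximatesCStar hB h,
    fun Λ _ _ _ A _ f _ L _ g hA h => .of_forall_exists_norm_sub_lt g hA fun x ε hε =>
      h.exists_norm_sub_lt x hε⟩
  · exact hA.of_mul_mul_mem fun b hb c hc a => hB.mul_mul_mem hb hc a
  · exact hA.of_mul_mul_mem fun b _ c hc a => I.mul_mem_left _ _ hc
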